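/- Let $H$ be any separable infinite-dimensional complex Hilbert space. Call a bounded linear operator $T$ on a complex Banach space $X$ hypercyclic if there is $x\in X$ such that $\{T^n x : n\ge 0\}$ is dense in $X$, and hereditarily hypercyclic if for every sequence $(t_n)_{n\ge 0}$ of nonnegative integers with $t_n\to\infty$ there is $x\in X$ such that $\{T^{t_n}x : n\ge 0\}$ is dense in $X$. Then there exist bounded linear operators $A$ and $B$ on $H$ such that the spectra $\sigma(A)$ and $\sigma(B)$ are connected and contain $0$, the operators $I+A$ and $e^B$ are hereditarily hypercyclic, and the operators $e^A$ and $I+B$ are not hypercyclic. Consequently, both parts of the following question of Bermúdez, Bonilla, Conejero and Peris (Question B$^2$CP) have a negative answer: if $X$ is a complex Banach space and $T$ is a bounded linear operator on $X$ whose spectrum is connected and contains $0$, does hypercyclicity of $I+T$ imply hypercyclicity of $e^T$, and does hypercyclicity of $e^T$ imply hypercyclicity of $I+T$? -/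

import Mathlib

universe u

/-- A family `T` of maps from `X` to `Y` is universal if some `x : X` has a dense orbit
`{T i x}` in `Y`. -/
def IsUniversalFamily {ι X Y : Type*} [TopologicalSpace Y] (T : ι → X → Y) : Prop :=
  ∃ x : X, Dense (Set.range fun i => T i x)

/-- `T` is hypercyclic if the family `(T ^ n)`, `n = 0, 1, 2, …`, is universal. -/
def IsHypercyclic {X : Type*} [NormedAddCommGroup X] [NormedSpace ℂ X]
    (T : X →L[ℂ] X) : Prop :=
  IsUniversalFamily fun (n : ℕ) (x : X) => (T ^ n) x

/-- `T` is hereditarily hypercyclic if for every sequence `t` of nonnegative integers tending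
to infinity, the family `(T ^ t n)`, `n = 0, 1, 2, …`, is universal. -/
def IsHereditarilyHypercyclic {X : Type*} [NormedAddCommGroup X] [NormedSpace ℂ X]
    (T : X →L[ℂ] X) : Prop :=
  ∀ t : ℕ → ℕ, Filter.Tendsto t Filter.atTop Filter.atTop →
    IsUniversalFamily fun (n : ℕ) (x : X) => (T ^ t n) x

/-! Up to similarity everything is multiplication on the Sobolev space H^{-1} of the circle: the
weight 1/(1+|k|) on Fourier coefficients turns it into ℓ²(ℤ), and the shift `decayShift` is
multiplication by z, written U. The operators are A = U - 1 and B = U - U⁻¹. Since U has the whole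
unit circle as spectrum, σ(A) and σ(B) are its images under z - 1 and z - 1/z, connected and
containing 0.

If |u| ≤ 1 on the circle and u' = uc, where ' is the derivation [N, ·] by the position operator N,
then N uⁿ = uⁿ N + n uⁿ c. The factor n gives two opposite effects.

Hypercyclicity: n uⁿ c z is bounded in H^{-1} for z in the domain of N, so uⁿ c z tends to 0. This
applies to u = z and u = exp(z - 1/z) and to their inverses, all unimodular, and a Kitai criterion
concludes.

Non-hypercyclicity: for (a, v) = (z - 1, e^a), or a = z - 1/z and v = (1 + a)⁻¹, the inequality |v|²
+ |av|² ≤ 1 holds. It makes n a² vⁿ bounded, which absorbs the factor n, so A² e^{nA} and B² (1 +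
B)^{-n} are bounded in n. A nonzero L with L Vⁿ bounded prevents both V and its inverse from being
hypercyclic.

The relation `IsLift` encodes this calculus with bounded operators only: D is the weight, E = DN,
and D K + E K is the whole space. -/

theorem hasSum_exp_apply {Y : Type*} [NormedAddCommGroup Y] [NormedSpace ℂ Y] [CompleteSpace Y]
    (f : Y →L[ℂ] Y) (x : Y) :
    HasSum (fun n : ℕ => ((n.factorial : ℂ)⁻¹) • (f ^ n) x) (NormedSpace.exp f x) :=
  (NormedSpace.exp_series_hasSum_exp' (𝕂 := ℂ) f).mapL (ContinuousLinearMap.apply ℂ Y x)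

/-! ### Calculus of lifts: Leibniz, power, inverse and exponential rules -/

/-- `IsLift D E g G g'` says that `G` is induced by `g` through `D`, and that the commutator of
`E` with the pair `(g, G)` is `D` composed with `g'`; here `g'` plays the role of a derivation
applied to `g`. -/
structure IsLift {K X : Type*} [NormedAddCommGroup K] [NormedSpace ℂ K] [NormedAddCommGroup X]
    [NormedSpace ℂ X] (D E : K →L[ℂ] X) (g : K →L[ℂ] K) (G : X →L[ℂ] X) (g' : K →L[ℂ] K) :
    Prop where
  map_left : ∀ x, D (g x) = G (D x)
  map_right : ∀ x, E (g x) = G (E x) + D (g' x)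

namespace IsLift

variable {K X : Type*} [NormedAddCommGroup K] [NormedSpace ℂ K] [NormedAddCommGroup X]
  [NormedSpace ℂ X] {D E : K →L[ℂ] X} {g h g' h' c : K →L[ℂ] K} {G H : X →L[ℂ] X}

theorem one : IsLift D E 1 1 0 := ⟨by simp, by simp⟩

theorem add (hg : IsLift D E g G g') (hh : IsLift D E h H h') :
    IsLift D E (g + h) (G + H) (g' + h') :=
  ⟨fun x => by simp [hg.map_left, hh.map_left],
    fun x => by simp [hg.map_right, hh.map_right]; abel⟩

theorem neg (hg : IsLift D E g G g') : IsLift D E (-g) (-G) (-g') :=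
  ⟨fun x => by simp [hg.map_left], fun x => by simp [hg.map_right]; abel⟩

theorem sub (hg : IsLift D E g G g') (hh : IsLift D E h H h') :
    IsLift D E (g - h) (G - H) (g' - h') := by
  simpa only [sub_eq_add_neg] using hg.add hh.neg

theorem mul (hg : IsLift D E g G g') (hh : IsLift D E h H h') :
    IsLift D E (g * h) (G * H) (g * h' + g' * h) :=
  ⟨fun x => by simp [hg.map_left, hh.map_left], fun x => by
    simp only [mul_apply_eq_comp, add_apply, hg.map_right,
      hh.map_right, hg.map_left, map_add, add_assoc]⟩

theorem pow (hg : IsLift D E g G g') (hc : Commute g g') (n : ℕ) :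
    IsLift D E (g ^ (n + 1)) (G ^ (n + 1)) ((n + 1 : ℂ) • (g ^ n * g')) := by
  induction n with
  | zero => simpa using hg
  | succ n ih =>
    have := ih.mul hg
    rw [← pow_succ, ← pow_succ] at this
    convert this using 1
    have : g ^ n * g' * g = g ^ (n + 1) * g' := by
      rw [mul_assoc, ← hc.eq, ← mul_assoc, pow_succ]
    rw [smul_mul_assoc, this, Nat.cast_succ, add_smul (n + 1 : ℂ), one_smul, add_comm]

theorem pow_of_logDeriv (hg : IsLift D E g G (g * c)) (hc : Commute g c) (n : ℕ) :
    IsLift D E (g ^ n) (G ^ n) ((n : ℂ) • (g ^ n * c)) := by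
  cases n with
  | zero => simpa using IsLift.one
  | succ n =>
    have := hg.pow ((Commute.refl g).mul_right hc) n
    rw [← mul_assoc, ← pow_succ] at this
    exact_mod_cast this

/-- Differentiating g h = 1 gives h' = -h g' h, here in the form h * c required by
`pow_of_logDeriv`. -/
theorem inv (hg : IsLift D E g G g') (h₁ : g * h = 1) (hH : H * G = 1) : IsLift D E h H (h * -(g' * h)) := by
  have e₁ : ∀ x, g (h x) = x := fun x => by
    simpa using congrArg (fun f : K →L[ℂ] K => f x) h₁
  have eH : ∀ x, H (G x) = x := fun x => by
    simpa using congrArg (fun f : X →L[ℂ] X => f x) hH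
  have left : ∀ x, D (h x) = H (D x) := fun x => by
    rw [← eH (D (h x)), ← hg.map_left, e₁]
  refine ⟨left, fun x => ?_⟩
  have := congrArg H (hg.map_right (h x))
  rw [e₁, map_add, eH, ← left] at this
  rw [this]
  simp

theorem exp [CompleteSpace K] [CompleteSpace X] (hg : IsLift D E g G g') (hc : Commute g g') :
    IsLift D E (NormedSpace.exp g) (NormedSpace.exp G) (NormedSpace.exp g * g') := by
  have left : ∀ n x, D ((g ^ n) x) = (G ^ n) (D x) := by
    intro n x
    induction n with
    | zero => simp
    | succ n ih => rw [pow_succ', pow_succ', mul_apply_eq_comp, mul_apply_eq_comp,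
        hg.map_left, ih]
  refine ⟨fun x => ?_, fun x => ?_⟩
  · refine ((hasSum_exp_apply g x).mapL D).unique ?_
    convert hasSum_exp_apply G (D x) using 2 with n
    rw [map_smul, left]
  · rw [← sub_eq_iff_eq_add']
    refine (((hasSum_exp_apply g x).mapL E).sub (hasSum_exp_apply G (E x))).unique ?_
    -- The zeroth term of the commutator series vanishes. After the index shift, (n+1)/(n+1)! = 1/n!
    -- matches it with the series of exp(g) g'.
    rw [← hasSum_nat_add_iff' 1, mul_apply_eq_comp]
    simp only [Finset.range_one, Finset.sum_singleton, Nat.factorial_zero, Nat.cast_one, inv_one,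
      pow_zero, one_apply_eq_self, one_smul, sub_self, sub_zero]
    convert (hasSum_exp_apply g (g' x)).mapL D using 2 with n
    have hn : (n + 1 : ℂ) ≠ 0 := by exact_mod_cast n.succ_ne_zero
    rw [map_smul, (hg.pow hc n).map_right, smul_add, add_sub_cancel_left, smul_apply,
      map_smul, map_smul, smul_smul, mul_apply_eq_comp, Nat.factorial_succ]
    congr 1
    push_cast
    field_simp

end IsLift

/-! ### Criteria for and against hypercyclicity -/

/-- A Kitai-type criterion. -/
theorem isHereditarilyHypercyclic_of_dense {X : Type*} [NormedAddCommGroup X] [NormedSpace ℂ X]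
    [CompleteSpace X] [TopologicalSpace.SeparableSpace X] {U V : X →L[ℂ] X} (hUV : U * V = 1)
    (hd : Dense {x : X | Filter.Tendsto (fun n : ℕ => (U ^ n) x) Filter.atTop (nhds 0) ∧
      Filter.Tendsto (fun n : ℕ => (V ^ n) x) Filter.atTop (nhds 0)}) :
    IsHereditarilyHypercyclic U := by
  intro t ht
  have : SecondCountableTopology X := UniformSpace.secondCountable_of_separable X
  have hpow : ∀ n : ℕ, U ^ n * V ^ n = 1 := by
    intro n
    induction n with
    | zero => simp
    | succ n ih => rw [pow_succ, pow_succ', mul_assoc, ← mul_assoc U, hUV, one_mul, ih]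
  have hpow' : ∀ (n : ℕ) (y : X), (U ^ n) ((V ^ n) y) = y := fun n y => by
    rw [← mul_apply_eq_comp, hpow, one_apply_eq_self]
  let b := TopologicalSpace.countableBasis X
  have hb := TopologicalSpace.isBasis_countableBasis X
  have hG : Dense (⋂ s ∈ b, ⋃ n, (fun x => (U ^ t n) x) ⁻¹' s) := by
    refine dense_biInter_of_isOpen (fun s hs => isOpen_iUnion fun n =>
      (hb.isOpen hs).preimage (U ^ t n).continuous)
      (TopologicalSpace.countable_countableBasis X) fun s hs => ?_
    rw [dense_iff_inter_open]
    intro W hW hWne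
    obtain ⟨w, hwW, hw⟩ := hd.inter_open_nonempty W hW hWne
    obtain ⟨y, hys, hy⟩ := hd.inter_open_nonempty s (hb.isOpen hs)
      (TopologicalSpace.nonempty_of_mem_countableBasis hs)
    -- The perturbation w + V^{t n} y of w is sent by U^{t n} close to y, so each set in the Baire
    -- intersection is dense.
    have h1 : Filter.Tendsto (fun n => w + (V ^ t n) y) Filter.atTop (nhds w) := by
      simpa using tendsto_const_nhds.add (hy.2.comp ht)
    have h2 : Filter.Tendsto (fun n => (U ^ t n) (w + (V ^ t n) y)) Filter.atTop (nhds y) := by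
      simp only [map_add, hpow']
      simpa using (hw.1.comp ht).add_const y
    obtain ⟨n, hn1, hn2⟩ := ((h1.eventually (hW.mem_nhds hwW)).and
      (h2.eventually ((hb.isOpen hs).mem_nhds hys))).exists
    exact ⟨_, hn1, Set.mem_iUnion.2 ⟨n, hn2⟩⟩
  obtain ⟨x, hx⟩ := hG.nonempty
  refine ⟨x, hb.dense_iff.2 fun s hs _ => ?_⟩
  obtain ⟨n, hn⟩ := Set.mem_iUnion.1 (Set.mem_iInter₂.1 hx s hs)
  exact ⟨_, hn, n, rfl⟩

theorem isHereditarilyHypercyclic_of_dense_span {X : Type*} [NormedAddCommGroup X]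
    [NormedSpace ℂ X] [CompleteSpace X] [TopologicalSpace.SeparableSpace X] {U V : X →L[ℂ] X}
    (hUV : U * V = 1) {s : Set X} (hs : Dense (Submodule.span ℂ s : Set X))
    (hU : ∀ x ∈ s, Filter.Tendsto (fun n : ℕ => (U ^ n) x) Filter.atTop (nhds 0))
    (hV : ∀ x ∈ s, Filter.Tendsto (fun n : ℕ => (V ^ n) x) Filter.atTop (nhds 0)) :
    IsHereditarilyHypercyclic U := by
  have key : ∀ W : X →L[ℂ] X,
      (∀ x ∈ s, Filter.Tendsto (fun n : ℕ => (W ^ n) x) Filter.atTop (nhds 0)) →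
      ∀ x ∈ Submodule.span ℂ s,
        Filter.Tendsto (fun n : ℕ => (W ^ n) x) Filter.atTop (nhds 0) := by
    intro W hW x hx
    induction hx using Submodule.span_induction with
    | mem x hx => exact hW x hx
    | zero => simp only [map_zero, tendsto_const_nhds]
    | add x y _ _ hx hy => simpa only [map_add, add_zero] using hx.add hy
    | smul r x _ hx => simpa only [map_smul, smul_zero] using hx.const_smul r
  exact isHereditarilyHypercyclic_of_dense hUV
    (hs.mono fun x hx => ⟨key U hU x hx, key V hV x hx⟩)

theorem exists_lt_norm_apply {X : Type*} [NormedAddCommGroup X] [NormedSpace ℂ X]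
    {L : X →L[ℂ] X} (hL : L ≠ 0) (C : ℝ) : ∃ y, C < ‖L y‖ := by
  obtain ⟨y, hy⟩ : ∃ y, L y ≠ 0 := by
    by_contra! h
    exact hL (ContinuousLinearMap.ext h)
  obtain ⟨n, hn⟩ := exists_nat_gt (C / ‖L y‖)
  refine ⟨(n : ℂ) • y, ?_⟩
  rw [map_smul, norm_smul, Complex.norm_natCast]
  exact (div_lt_iff₀ (norm_pos_iff.2 hy)).1 hn

theorem not_isHypercyclic_of_norm_le {X : Type*} [NormedAddCommGroup X] [NormedSpace ℂ X]
    {L V : X →L[ℂ] X} (hL : L ≠ 0) {C : ℝ} (h : ∀ (n : ℕ) x, ‖L ((V ^ n) x)‖ ≤ C * ‖x‖) :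
    ¬ IsHypercyclic V := by
  rintro ⟨x, hx⟩
  obtain ⟨y, hy⟩ := exists_lt_norm_apply hL (C * ‖x‖)
  obtain ⟨_, hz, n, rfl⟩ := hx.inter_open_nonempty {z | C * ‖x‖ < ‖L z‖}
    (isOpen_lt continuous_const (by fun_prop)) ⟨y, hy⟩
  exact absurd hz (not_lt.2 (h n x))

/-- In a dense orbit of U pick n with ‖L Uⁿ x‖ > C, then a later m with ‖U^m x‖ < 1. As Uⁿ x =
V^{m-n} U^m x, the bound gives ‖L Uⁿ x‖ ≤ C, a contradiction. -/
theorem not_isHypercyclic_of_norm_inv_le {X : Type*} [NormedAddCommGroup X] [NormedSpace ℂ X]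
    {L U V : X →L[ℂ] X} (hVU : V * U = 1) (hL : L ≠ 0) {C : ℝ}
    (h : ∀ (n : ℕ) x, ‖L ((V ^ n) x)‖ ≤ C * ‖x‖) :
    ¬ IsHypercyclic U := by
  have hpow : ∀ n : ℕ, V ^ n * U ^ n = 1 := by
    intro n
    induction n with
    | zero => simp
    | succ n ih => rw [pow_succ, pow_succ', mul_assoc, ← mul_assoc V, hVU, one_mul, ih]
  rintro ⟨x, hx⟩
  obtain ⟨y, hy⟩ := exists_lt_norm_apply hL C
  obtain ⟨_, hz, n, rfl⟩ := hx.inter_open_nonempty {z | C < ‖L z‖}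
    (isOpen_lt continuous_const (by fun_prop)) ⟨y, hy⟩
  have : Nontrivial X := by
    by_contra hX
    rw [not_nontrivial_iff_subsingleton] at hX
    exact hL (Subsingleton.elim _ _)
  have : ∀ z : X, (nhdsWithin z {z}ᶜ).NeBot := fun z => Module.punctured_nhds_neBot ℂ X z
  -- There are no isolated points, so the orbit stays dense without its terms of index at most n;
  -- this forces m > n below.
  have hx' := hx.sdiff_finite ((Set.finite_Iic n).image fun m => (U ^ m) x)
  obtain ⟨_, hm, ⟨m, rfl⟩, hmn⟩ := hx'.inter_open_nonempty (Metric.ball 0 1) Metric.isOpen_ball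
    ⟨0, Metric.mem_ball_self one_pos⟩
  have hnm : n < m := by
    by_contra! hle
    exact hmn ⟨m, hle, rfl⟩
  have hV : (V ^ (m - n)) ((U ^ m) x) = (U ^ n) x := by
    rw [← mul_apply_eq_comp, ← Nat.sub_add_cancel hnm.le, pow_add U, ← mul_assoc,
      Nat.add_sub_cancel, hpow, one_mul]
  have hle := h (m - n) ((U ^ m) x)
  rw [hV] at hle
  have hC : 0 ≤ C := by
    by_contra! hC
    exact hL (ContinuousLinearMap.ext fun z => norm_le_zero_iff.1 <|
      (h 0 z).trans (mul_nonpos_of_nonpos_of_nonneg hC.le (norm_nonneg z)))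
  have hlt : ‖(U ^ m) x‖ < 1 := by simpa using hm
  have hz' : C < ‖L ((U ^ n) x)‖ := hz
  nlinarith

/-! ### Growth estimates for contractions and their lifts -/

theorem norm_pow_apply_le {K : Type*} [NormedAddCommGroup K] [NormedSpace ℂ K] {u : K →L[ℂ] K}
    (hu : ∀ x, ‖u x‖ ≤ ‖x‖) (n : ℕ) (z : K) : ‖(u ^ n) z‖ ≤ ‖z‖ := by
  induction n with
  | zero => simp
  | succ n ih => rw [pow_succ', mul_apply_eq_comp]; exact (hu _).trans ih

/-- If `u` is a contraction with logarithmic derivative `c`, then the lift `U` of `u` satisfies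
`U ^ n (D (c z)) → 0` whenever `E z` is in the range of `D`. -/
theorem IsLift.tendsto_pow_apply {K X : Type*} [NormedAddCommGroup K] [NormedSpace ℂ K]
    [NormedAddCommGroup X] [NormedSpace ℂ X] {D E : K →L[ℂ] X} {u c : K →L[ℂ] K} {U : X →L[ℂ] X}
    (h : IsLift D E u U (u * c)) (hc : Commute u c) (hu : ∀ x, ‖u x‖ ≤ ‖x‖) {z w : K}
    (hz : E z = D w) :
    Filter.Tendsto (fun n : ℕ => (U ^ n) (D (c z))) Filter.atTop (nhds 0) := by
  -- This is the power rule solved for its derivative term; E z = D w lets `map_left` control the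
  -- remaining Uⁿ (E z).
  have hn : ∀ n : ℕ, (n : ℂ) • (U ^ n) (D (c z)) = E ((u ^ n) z) - D ((u ^ n) w) := by
    intro n
    have hp := h.pow_of_logDeriv hc n
    rw [hp.map_right, hz, hp.map_left, add_sub_cancel_left, smul_apply, map_smul,
      mul_apply_eq_comp, hp.map_left]
  have hbound : ∀ n : ℕ, ‖(U ^ n) (D (c z))‖ * n ≤ ‖E‖ * ‖z‖ + ‖D‖ * ‖w‖ := by
    intro n
    rw [mul_comm, ← Complex.norm_natCast, ← norm_smul, hn]
    refine (norm_sub_le _ _).trans (add_le_add ?_ ?_)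
    · exact (E.le_opNorm _).trans (by gcongr; exact norm_pow_apply_le hu n z)
    · exact (D.le_opNorm _).trans (by gcongr; exact norm_pow_apply_le hu n w)
  refine squeeze_zero_norm' ?_ (tendsto_const_div_atTop_nhds_zero_nat (‖E‖ * ‖z‖ + ‖D‖ * ‖w‖))
  filter_upwards [Filter.eventually_gt_atTop 0] with n hn0
  exact (le_div_iff₀ (by exact_mod_cast hn0)).2 (hbound n)

theorem IsLift.exists_norm_pow_le {K X : Type*} [NormedAddCommGroup K] [NormedSpace ℂ K]
    [NormedAddCommGroup X] [NormedSpace ℂ X] {D E : K →L[ℂ] X} {u c : K →L[ℂ] K} {U : X →L[ℂ] X}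
    (hDE : ∀ x, ∃ p q, x = D p + E q ∧ ‖p‖ ≤ ‖x‖ ∧ ‖q‖ ≤ ‖x‖)
    (h : IsLift D E u U (u * c)) (hc : Commute u c) (hu : ∀ x, ‖u x‖ ≤ ‖x‖) :
    ∃ C : ℝ, ∀ n : ℕ, ‖U ^ n‖ ≤ C * (n + 1) := by
  refine ⟨‖D‖ + ‖E‖ + ‖D‖ * ‖c‖, fun n => ?_⟩
  refine ContinuousLinearMap.opNorm_le_bound _ (by positivity) fun x => ?_
  obtain ⟨p, q, hx, hp, hq⟩ := hDE x
  have hl := h.pow_of_logDeriv hc n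
  have e : (U ^ n) x = D ((u ^ n) p) + (E ((u ^ n) q) - (n : ℂ) • D ((u ^ n) (c q))) := by
    have h1 := hl.map_right q
    rw [smul_apply, map_smul, mul_apply_eq_comp] at h1
    rw [h1, add_sub_cancel_right, hl.map_left, ← map_add, ← hx]
  have b1 : ‖D ((u ^ n) p)‖ ≤ ‖D‖ * ‖x‖ :=
    (D.le_opNorm _).trans (by gcongr; exact (norm_pow_apply_le hu n p).trans hp)
  have b2 : ‖E ((u ^ n) q)‖ ≤ ‖E‖ * ‖x‖ :=
    (E.le_opNorm _).trans (by gcongr; exact (norm_pow_apply_le hu n q).trans hq)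
  have b3 : ‖(n : ℂ) • D ((u ^ n) (c q))‖ ≤ n * (‖D‖ * (‖c‖ * ‖x‖)) := by
    rw [norm_smul, Complex.norm_natCast]
    gcongr
    refine (D.le_opNorm _).trans ?_
    gcongr
    exact (norm_pow_apply_le hu n _).trans ((c.le_opNorm q).trans (by gcongr))
  rw [e]
  refine (norm_add_le _ _).trans ((add_le_add b1 ((norm_sub_le _ _).trans
    (add_le_add b2 b3))).trans ?_)
  have h1 : 0 ≤ (n : ℝ) * ((‖D‖ + ‖E‖) * ‖x‖) := by positivity
  have h2 : 0 ≤ ‖D‖ * ‖c‖ * ‖x‖ := by positivity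
  linarith

/-- A contraction `v` with `‖v z‖² + ‖a v z‖² ≤ ‖z‖²` satisfies a Ritt-type estimate. -/
theorem mul_norm_sq_apply_pow_le {K : Type*} [NormedAddCommGroup K] [NormedSpace ℂ K]
    {a v : K →L[ℂ] K} (hav : Commute a v) (h : ∀ z, ‖v z‖ ^ 2 + ‖a (v z)‖ ^ 2 ≤ ‖z‖ ^ 2)
    (n : ℕ) (z : K) : ‖(v ^ n) z‖ ^ 2 + n * ‖a ((v ^ n) z)‖ ^ 2 ≤ ‖z‖ ^ 2 := by
  induction n with
  | zero => simp
  | succ n ih =>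
    rw [pow_succ' v, mul_apply_eq_comp]
    have h1 := h ((v ^ n) z)
    -- The hypothesis applied to a vⁿ z shows that ‖a vⁿ z‖ decreases in n, so the n increments
    -- already collected may be replaced by the newest one.
    have h2 : ‖a (v ((v ^ n) z))‖ ^ 2 ≤ ‖a ((v ^ n) z)‖ ^ 2 := by
      rw [← mul_apply_eq_comp a v, hav.eq, mul_apply_eq_comp]
      nlinarith [h (a ((v ^ n) z)), sq_nonneg ‖a (v (a ((v ^ n) z)))‖]
    rw [Nat.cast_succ]
    nlinarith [mul_le_mul_of_nonneg_left h2 (Nat.cast_nonneg (α := ℝ) n)]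

theorem mul_norm_mul_self_apply_pow_le {K : Type*} [NormedAddCommGroup K] [NormedSpace ℂ K]
    {a v : K →L[ℂ] K} (hav : Commute a v) (h : ∀ z, ‖v z‖ ^ 2 + ‖a (v z)‖ ^ 2 ≤ ‖z‖ ^ 2)
    (n : ℕ) (z : K) : n * ‖a (a ((v ^ n) z))‖ ≤ (2 + ‖a‖ ^ 2) * ‖z‖ := by
  have hv : ∀ (m : ℕ) z, ‖(v ^ m) z‖ ≤ ‖z‖ := fun m z =>
    norm_pow_apply_le (fun w =>
    (sq_le_sq₀ (norm_nonneg _) (norm_nonneg _)).1 (by linarith [h w, sq_nonneg ‖a (v w)‖])) m z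
  -- The previous estimate says that √m a v^m is a contraction; composing it with itself gives m a²
  -- v^{2m}. An odd exponent costs one extra term, bounded by ‖a‖².
  have heven : ∀ (m : ℕ) z, m * ‖a (a ((v ^ (m + m)) z))‖ ≤ ‖z‖ := by
    intro m z
    refine (sq_le_sq₀ (by positivity) (norm_nonneg _)).1 ?_
    have h1 := mul_norm_sq_apply_pow_le hav h m z
    have h2 := mul_norm_sq_apply_pow_le hav h m (a ((v ^ m) z))
    have e : (v ^ m) (a ((v ^ m) z)) = a ((v ^ (m + m)) z) := by
      rw [← mul_apply_eq_comp, ← (hav.pow_right m).eq, pow_add, mul_apply_eq_comp,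
        mul_apply_eq_comp]
    rw [e] at h2
    have hm : (0 : ℝ) ≤ m := Nat.cast_nonneg m
    have h3 := mul_le_mul_of_nonneg_left h2 hm
    nlinarith [sq_nonneg ‖(v ^ m) z‖, mul_nonneg hm (sq_nonneg ‖a ((v ^ (m + m)) z)‖)]
  have haa : ∀ w, ‖a (a w)‖ ≤ ‖a‖ ^ 2 * ‖w‖ := fun w => by
    rw [sq, mul_assoc]
    exact (a.le_opNorm _).trans (by gcongr; exact a.le_opNorm w)
  obtain ⟨m, hm | hm⟩ := n.even_or_odd'
  · have := heven m z
    rw [← two_mul, ← hm] at this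
    have hn : (n : ℝ) = 2 * m := by exact_mod_cast hm
    rw [hn]
    nlinarith [mul_nonneg (sq_nonneg ‖a‖) (norm_nonneg z)]
  · have h1 := heven m (v z)
    have e : (v ^ (m + m)) (v z) = (v ^ n) z := by
      rw [← mul_apply_eq_comp, ← pow_succ, hm, two_mul]
    have h2 := haa ((v ^ n) z)
    have h3 : ‖v z‖ ≤ ‖z‖ := by simpa using hv 1 z
    have hn : (n : ℝ) = 2 * m + 1 := by exact_mod_cast hm
    rw [e] at h1
    have h4 := mul_le_mul_of_nonneg_left (hv n z) (sq_nonneg ‖a‖)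
    rw [hn]
    nlinarith

/-- Boundedness of `A² V^n` for the lifts `A`, `V` of a commuting pair `a`, `v`. -/
theorem IsLift.exists_norm_le {K X : Type*} [NormedAddCommGroup K] [NormedSpace ℂ K]
    [NormedAddCommGroup X] [NormedSpace ℂ X] {D E : K →L[ℂ] X} {a a' v c : K →L[ℂ] K}
    {A V : X →L[ℂ] X} (hDE : ∀ x, ∃ p q, x = D p + E q ∧ ‖p‖ ≤ ‖x‖ ∧ ‖q‖ ≤ ‖x‖)
    (ha : IsLift D E a A a') (hv : IsLift D E v V (v * c)) 
    (hav : Commute a v) (hvc : Commute v c)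
    (h : ∀ z, ‖v z‖ ^ 2 + ‖a (v z)‖ ^ 2 ≤ ‖z‖ ^ 2) :
    ∃ C : ℝ, ∀ (n : ℕ) x, ‖(A * A) ((V ^ n) x)‖ ≤ C * ‖x‖ := by
  have hpow : ∀ (n : ℕ) z, ‖(v ^ n) z‖ ≤ ‖z‖ := fun n z =>
    norm_pow_apply_le (fun w =>
    (sq_le_sq₀ (norm_nonneg _) (norm_nonneg _)).1 (by linarith [h w, sq_nonneg ‖a (v w)‖])) n z
  refine ⟨‖D‖ * ‖a * a‖ + ‖E‖ * ‖a * a‖ +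
    ‖D‖ * ((2 + ‖a‖ ^ 2) * ‖c‖ + ‖a * a' + a' * a‖), fun n x => ?_⟩
  obtain ⟨p, q, hx, hp, hq⟩ := hDE x
  have hl := (ha.mul ha).mul (hv.pow_of_logDeriv hvc n)
  -- Only one term carries the factor n, and it also carries a² vⁿ, so the Ritt-type bound applies
  -- to it.
  have e : (A * A) ((V ^ n) x) = D ((a * a) ((v ^ n) p)) + (E ((a * a) ((v ^ n) q)) -
      D (((n : ℂ) • (a (a ((v ^ n) (c q))))) + (a * a' + a' * a) ((v ^ n) q))) := by
    have h1 := hl.map_left p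
    have h2 := hl.map_right q
    simp only [mul_apply_eq_comp, add_apply, smul_apply, map_smul, map_add] at h1 h2 ⊢
    rw [hx, h1, h2]
    simp only [map_add]
    abel
  rw [e]
  have b1 : ‖D ((a * a) ((v ^ n) p))‖ ≤ ‖D‖ * ‖a * a‖ * ‖x‖ := by
    rw [mul_assoc]
    refine (D.le_opNorm _).trans ?_
    gcongr
    refine ((a * a).le_opNorm _).trans ?_
    gcongr
    exact (hpow n p).trans hp
  have b2 : ‖E ((a * a) ((v ^ n) q))‖ ≤ ‖E‖ * ‖a * a‖ * ‖x‖ := by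
    rw [mul_assoc]
    refine (E.le_opNorm _).trans ?_
    gcongr
    refine ((a * a).le_opNorm _).trans ?_
    gcongr
    exact (hpow n q).trans hq
  have b3 : ‖(n : ℂ) • (a (a ((v ^ n) (c q))))‖ ≤ (2 + ‖a‖ ^ 2) * ‖c‖ * ‖x‖ := by
    rw [norm_smul, Complex.norm_natCast, mul_assoc]
    refine (mul_norm_mul_self_apply_pow_le hav h n (c q)).trans ?_
    gcongr
    exact (c.le_opNorm q).trans (by gcongr)
  have b4 : ‖(a * a' + a' * a) ((v ^ n) q)‖ ≤ ‖a * a' + a' * a‖ * ‖x‖ := by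
    refine ((a * a' + a' * a).le_opNorm _).trans ?_
    gcongr
    exact (hpow n q).trans hq
  have b5 : ‖D (((n : ℂ) • (a (a ((v ^ n) (c q))))) + (a * a' + a' * a) ((v ^ n) q))‖ ≤
      ‖D‖ * (((2 + ‖a‖ ^ 2) * ‖c‖ + ‖a * a' + a' * a‖) * ‖x‖) := by
    refine (D.le_opNorm _).trans ?_
    gcongr
    refine (norm_add_le _ _).trans ?_
    rw [add_mul]
    exact add_le_add b3 b4
  refine (norm_add_le _ _).trans ((add_le_add b1 ((norm_sub_le _ _).trans
    (add_le_add b2 b5))).trans (le_of_eq (by ring)))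

open scoped InnerProductSpace in
theorem norm_sq_exp_apply_add_le {K : Type*} [NormedAddCommGroup K] [InnerProductSpace ℂ K]
    [CompleteSpace K] (a : K →L[ℂ] K) {s : ℝ} (hs : 0 ≤ s)
    (ha : ∀ w, 2 * (⟪w, a w⟫_ℂ).re + s * ‖a w‖ ^ 2 ≤ 0) (z : K) :
    ‖NormedSpace.exp a z‖ ^ 2 + s * ‖a (NormedSpace.exp a z)‖ ^ 2 ≤ ‖z‖ ^ 2 := by
  let : InnerProductSpace ℝ K := InnerProductSpace.rclikeToReal ℂ K
  let y : ℝ → K := fun t => NormedSpace.exp (t • a) z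
  have hy : ∀ t, HasDerivAt y (a (y t)) t := fun t => by
    have h1 := hasDerivAt_exp_smul_const' (𝕂 := ℝ) a t
    exact (((ContinuousLinearMap.apply ℂ K z).restrictScalars ℝ).hasFDerivAt.comp_hasDerivAt t h1)
  have hay : ∀ t, HasDerivAt (fun t => a (y t)) (a (a (y t))) t := fun t =>
    (a.restrictScalars ℝ).hasFDerivAt.comp_hasDerivAt t (hy t)
  -- The factor t makes f 0 = ‖z‖². Its derivative contributes s‖a y‖², which the hypothesis at y t
  -- absorbs; the hypothesis at a (y t) handles the rest.
  let f : ℝ → ℝ := fun t => ‖y t‖ ^ 2 + (s * t) * ‖a (y t)‖ ^ 2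
  have hf : ∀ t, HasDerivAt f (2 * ⟪y t, a (y t)⟫_ℝ + ((s * 1) * ‖a (y t)‖ ^ 2 +
      (s * t) * (2 * ⟪a (y t), a (a (y t))⟫_ℝ))) t := fun t =>
    (hy t).norm_sq.add ((((hasDerivAt_id t).const_mul s)).mul (hay t).norm_sq)
  have hanti : AntitoneOn f (Set.Icc 0 1) := by
    refine antitoneOn_of_deriv_nonpos (convex_Icc 0 1)
      (fun t _ => (hf t).continuousAt.continuousWithinAt)
      (fun t _ => (hf t).differentiableAt.differentiableWithinAt) fun t ht => ?_
    rw [interior_Icc] at ht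
    rw [(hf t).deriv]
    have h1 := ha (y t)
    have h2 := ha (a (y t))
    have e1 : ⟪y t, a (y t)⟫_ℝ = (⟪y t, a (y t)⟫_ℂ).re := real_inner_eq_re_inner ℂ _ _
    have e2 : ⟪a (y t), a (a (y t))⟫_ℝ = (⟪a (y t), a (a (y t))⟫_ℂ).re :=
      real_inner_eq_re_inner ℂ _ _
    rw [e1, e2]
    have h3 : 2 * (⟪a (y t), a (a (y t))⟫_ℂ).re ≤ 0 := by
      linarith [mul_nonneg hs (sq_nonneg ‖a (a (y t))‖)]
    linarith [mul_nonpos_of_nonneg_of_nonpos (mul_nonneg hs ht.1.le) h3]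
  have := hanti (Set.left_mem_Icc.2 zero_le_one) (Set.right_mem_Icc.2 zero_le_one) zero_le_one
  simpa [f, y] using this

/-! ### Spectra under linear growth and under u ↦ u - u⁻¹ -/

/-- The spectrum of an element whose powers grow at most linearly lies in the closed unit disc. -/
theorem norm_le_one_of_mem_spectrum {R : Type*} [NormedRing R] [NormedAlgebra ℂ R]
    [CompleteSpace R] [NormOneClass R] {u : R} {C : ℝ} (h : ∀ n : ℕ, ‖u ^ n‖ ≤ C * (n + 1)) {z : ℂ}
    (hz : z ∈ spectrum ℂ u) : ‖z‖ ≤ 1 := by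
  by_contra! hlt
  have hpow : ∀ n : ℕ, ‖z‖ ^ n ≤ C * (n + 1) := fun n => by
    rw [← norm_pow]
    exact (spectrum.norm_le_norm_of_mem (spectrum.pow_mem_pow u n hz)).trans (h n)
  have h1 : Filter.Tendsto (fun n : ℕ => C * ((n : ℝ) ^ 1 / ‖z‖ ^ n + (n : ℝ) ^ 0 / ‖z‖ ^ n))
      Filter.atTop (nhds (C * (0 + 0))) :=
    ((tendsto_pow_const_div_const_pow_of_one_lt 1 hlt).add
      (tendsto_pow_const_div_const_pow_of_one_lt 0 hlt)).const_mul C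
  have h2 := ge_of_tendsto' h1 (b := 1) fun n => by
    rw [← add_div, ← mul_div_assoc, le_div_iff₀ (by positivity)]
    simpa using hpow n
  norm_num at h2

theorem norm_eq_one_of_mem_spectrum {R : Type*} [NormedRing R] [NormedAlgebra ℂ R]
    [CompleteSpace R] [NormOneClass R] {u v : R} (huv : u * v = 1) (hvu : v * u = 1) {C C' : ℝ}
    (hu : ∀ n : ℕ, ‖u ^ n‖ ≤ C * (n + 1)) (hv : ∀ n : ℕ, ‖v ^ n‖ ≤ C' * (n + 1)) {z : ℂ}
    (hz : z ∈ spectrum ℂ u) : ‖z‖ = 1 := by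
  refine le_antisymm (norm_le_one_of_mem_spectrum hu hz) ?_
  have hz0 : z ≠ 0 := by
    rintro rfl
    exact spectrum.zero_notMem ℂ ⟨⟨u, v, huv, hvu⟩, rfl⟩ hz
  have h1 : z⁻¹ ∈ spectrum ℂ v := by
    have := (spectrum.inv_mem_iff (r := Units.mk0 z hz0) (a := (⟨u, v, huv, hvu⟩ : Rˣ))).1 hz
    simpa using this
  have := norm_le_one_of_mem_spectrum hv h1
  rw [norm_inv] at this
  exact (inv_le_one₀ (norm_pos_iff.2 hz0)).1 this

/-- The commuting factorization (a - u)(-a⁻¹ - u) = -u((a - a⁻¹) - (u - v)) reduces invertibility to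
that of the two factors, and a and -a⁻¹ are exactly the two solutions of z - z⁻¹ = μ. -/
theorem spectrum_sub_inv {R : Type*} [Ring R] [Algebra ℂ R] {u v : R} (huv : u * v = 1)
    (hvu : v * u = 1) : spectrum ℂ (u - v) = (fun z : ℂ => z - z⁻¹) '' spectrum ℂ u := by
  have hu : IsUnit u := ⟨⟨u, v, huv, hvu⟩, rfl⟩
  have key : ∀ a : ℂ, a ≠ 0 → (a - a⁻¹ ∈ spectrum ℂ (u - v) ↔
      a ∈ spectrum ℂ u ∨ -a⁻¹ ∈ spectrum ℂ u) := by
    intro a ha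
    have hc : Commute (algebraMap ℂ R a - u) (algebraMap ℂ R (-a⁻¹) - u) :=
      Commute.sub_left (Algebra.commutes a _)
        (Commute.sub_right (Algebra.commutes (-a⁻¹) u).symm (Commute.refl u))
    have e : (algebraMap ℂ R a - u) * (algebraMap ℂ R (-a⁻¹) - u) =
        -(u * (algebraMap ℂ R (a - a⁻¹) - (u - v))) := by
      simp only [Algebra.algebraMap_eq_smul_one, mul_sub, sub_mul, smul_mul_assoc, one_mul,
        mul_smul_comm, mul_one, huv]
      match_scalars <;> field_simp
      ring
    have h := hc.isUnit_mul_iff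
    have hu' : ∀ x : R, IsUnit (u * x) ↔ IsUnit x := fun x =>
      hu.unit_spec ▸ hu.unit.isUnit_units_mul x
    rw [e, IsUnit.neg_iff, hu'] at h
    rw [spectrum.mem_iff, spectrum.mem_iff, spectrum.mem_iff, h]
    tauto
  ext μ
  constructor
  · intro hμ
    obtain ⟨a, ha⟩ : ∃ a : ℂ, 1 * (a * a) + (-μ) * a + (-1) = 0 :=
      exists_quadratic_eq_zero one_ne_zero (IsAlgClosed.exists_eq_mul_self _)
    have ha0 : a ≠ 0 := by rintro rfl; norm_num at ha
    have hμa : a - a⁻¹ = μ := by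
      field_simp
      linear_combination ha
    rw [← hμa, key a ha0] at hμ
    rcases hμ with h | h
    · exact ⟨a, h, hμa⟩
    · refine ⟨_, h, ?_⟩
      simp only [inv_neg, inv_inv]
      rw [← hμa]
      ring
  · rintro ⟨a, ha, rfl⟩
    have ha0 : a ≠ 0 := by
      rintro rfl
      exact spectrum.zero_notMem ℂ hu ha
    exact (key a ha0).2 (Or.inl ha)

/-! ### Weighted shifts on ℓ²(ℤ) and the model operators -/

theorem memℓp_weighted_shift {w : ℤ → ℂ} {C : ℝ} (hw : ∀ k, ‖w k‖ ≤ C) (m : ℤ)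
    (f : lp (fun _ : ℤ => ℂ) 2) : Memℓp (fun k => w k * f (k + m)) 2 := by
  have hs := (lp.memℓp f).summable (by norm_num)
  have hs' := ((Equiv.addRight m).summable_iff.2 hs).mul_left (C ^ 2)
  refine memℓp_gen (hs'.of_nonneg_of_le (fun k => by positivity) fun k => ?_)
  simp only [ENNReal.toReal_ofNat, Real.rpow_ofNat, Function.comp_apply, Equiv.coe_addRight,
    norm_mul, mul_pow]
  gcongr
  exact hw k

theorem norm_weighted_shift_le {w : ℤ → ℂ} {C : ℝ} (hw : ∀ k, ‖w k‖ ≤ C) (m : ℤ)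
    (f g : lp (fun _ : ℤ => ℂ) 2) (hg : ∀ k, g k = w k * f (k + m)) : ‖g‖ ≤ C * ‖f‖ := by
  have hC : 0 ≤ C := (norm_nonneg _).trans (hw 0)
  refine (sq_le_sq₀ (norm_nonneg _) (by positivity)).1 ?_
  have h2 : (0 : ℝ) < (2 : ENNReal).toReal := by norm_num
  have hf := lp.norm_rpow_eq_tsum h2 f
  have hg' := lp.norm_rpow_eq_tsum h2 g
  have hfs := (lp.memℓp f).summable h2
  have hgs := (lp.memℓp g).summable h2
  simp only [ENNReal.toReal_ofNat, Real.rpow_ofNat] at hf hg' hfs hgs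
  rw [mul_pow, hf, hg', ← (Equiv.addRight m).tsum_eq fun k => ‖f k‖ ^ 2, ← tsum_mul_left]
  refine hgs.tsum_le_tsum (fun k => ?_) (((Equiv.addRight m).summable_iff.2 hfs).mul_left _)
  rw [hg, norm_mul, mul_pow, Equiv.coe_addRight]
  exact mul_le_mul_of_nonneg_right (pow_le_pow_left₀ (norm_nonneg _) (hw k) 2) (sq_nonneg _)

/-- The weighted translation `f ↦ (k ↦ w k * f (k + m))` on `ℓ²(ℤ)`. -/
noncomputable def weightedShift (w : ℤ → ℂ) (m : ℤ) {C : ℝ} (hw : ∀ k, ‖w k‖ ≤ C) :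
    lp (fun _ : ℤ => ℂ) 2 →L[ℂ] lp (fun _ : ℤ => ℂ) 2 :=
  LinearMap.mkContinuous
    { toFun := fun f => ⟨fun k => w k * f (k + m), memℓp_weighted_shift hw m f⟩
      map_add' := fun f g => lp.ext (funext fun k => mul_add (w k) (f (k + m)) (g (k + m)))
      map_smul' := fun c f => lp.ext (funext fun k => mul_left_comm (w k) c (f (k + m))) } C
    fun f => norm_weighted_shift_le hw m f _ fun _ => rfl

theorem weightedShift_apply (w : ℤ → ℂ) (m : ℤ) {C : ℝ} (hw : ∀ k, ‖w k‖ ≤ C)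
    (f : lp (fun _ : ℤ => ℂ) 2) (k : ℤ) : weightedShift w m hw f k = w k * f (k + m) := rfl

theorem norm_weightedShift_apply_le (w : ℤ → ℂ) (m : ℤ) {C : ℝ} (hw : ∀ k, ‖w k‖ ≤ C)
    (f : lp (fun _ : ℤ => ℂ) 2) : ‖weightedShift w m hw f‖ ≤ C * ‖f‖ :=
  norm_weighted_shift_le hw m f _ fun _ => rfl

theorem weightedShift_single (w : ℤ → ℂ) (m : ℤ) {C : ℝ} (hw : ∀ k, ‖w k‖ ≤ C) (j : ℤ) (z : ℂ) :
    weightedShift w m hw (lp.single 2 j z) = lp.single 2 (j - m) (w (j - m) * z) := by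
  ext k
  rw [weightedShift_apply, lp.single_apply, lp.single_apply]
  by_cases h : k + m = j
  · obtain rfl : k = j - m := by omega
    simp
  · rw [Pi.single_eq_of_ne h, Pi.single_eq_of_ne (by omega), mul_zero]

/-- The weight `k ↦ 1 / (1 + |k|)`. -/
noncomputable def decayWeight (k : ℤ) : ℝ := (1 + |(k : ℝ)|)⁻¹

theorem decayWeight_pos (k : ℤ) : 0 < decayWeight k := by
  unfold decayWeight; positivity

theorem decayWeight_le_one (k : ℤ) : decayWeight k ≤ 1 :=
  inv_le_one_of_one_le₀ (by linarith [abs_nonneg (k : ℝ)])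

theorem decayWeight_ne_zero (k : ℤ) : (decayWeight k : ℂ) ≠ 0 := by
  exact_mod_cast (decayWeight_pos k).ne'

theorem norm_decayWeight_le (k : ℤ) : ‖(decayWeight k : ℂ)‖ ≤ 1 := by
  rw [Complex.norm_real, Real.norm_of_nonneg (decayWeight_pos k).le]
  exact decayWeight_le_one k

theorem decayWeight_add_abs_mul (k : ℤ) : decayWeight k + |(k : ℝ)| * decayWeight k = 1 := by
  unfold decayWeight
  field_simp

theorem norm_mul_decayWeight_le (k : ℤ) : ‖((k : ℂ) * decayWeight k)‖ ≤ 1 := by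
  rw [norm_mul, Complex.norm_real, Real.norm_of_nonneg (decayWeight_pos k).le,
    Complex.norm_intCast]
  linarith [decayWeight_add_abs_mul k, decayWeight_pos k]

theorem norm_decayWeight_div_le {j k : ℤ} (h : |(j - k : ℝ)| ≤ 1) :
    ‖(decayWeight k / decayWeight j : ℂ)‖ ≤ 2 := by
  rw [norm_div, Complex.norm_real, Complex.norm_real, Real.norm_of_nonneg (decayWeight_pos k).le,
    Real.norm_of_nonneg (decayWeight_pos j).le, div_le_iff₀ (decayWeight_pos j)]
  unfold decayWeight
  rw [← div_eq_mul_inv, inv_eq_one_div, div_le_div_iff₀ (by positivity) (by positivity)]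
  have := abs_sub_abs_le_abs_sub (j : ℝ) k
  linarith [abs_nonneg (k : ℝ)]

theorem norm_one_le_one (k : ℤ) : ‖(fun _ : ℤ => (1 : ℂ)) k‖ ≤ 1 := by simp

theorem norm_intCast_sign_le (k : ℤ) : ‖((k.sign : ℤ) : ℂ)‖ ≤ 1 := by
  rcases lt_trichotomy k 0 with h | rfl | h
  · simp [Int.sign_eq_neg_one_of_neg h]
  · simp
  · simp [Int.sign_eq_one_of_pos h]

/-- Multiplication by the decaying weight. -/
noncomputable def diagDecay : lp (fun _ : ℤ => ℂ) 2 →L[ℂ] lp (fun _ : ℤ => ℂ) 2 :=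
  weightedShift (fun k => decayWeight k) 0 norm_decayWeight_le

/-- Multiplication by `k / (1 + |k|)`. -/
noncomputable def diagPosition : lp (fun _ : ℤ => ℂ) 2 →L[ℂ] lp (fun _ : ℤ => ℂ) 2 :=
  weightedShift (fun k => k * decayWeight k) 0 norm_mul_decayWeight_le

/-- The bilateral shift by `1`. -/
noncomputable def bilateralShift : lp (fun _ : ℤ => ℂ) 2 →L[ℂ] lp (fun _ : ℤ => ℂ) 2 :=
  weightedShift (fun _ => 1) (-1) norm_one_le_one

/-- The inverse of the bilateral shift. -/
noncomputable def bilateralShiftInv : lp (fun _ : ℤ => ℂ) 2 →L[ℂ] lp (fun _ : ℤ => ℂ) 2 :=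
  weightedShift (fun _ => 1) 1 norm_one_le_one

/-- The bilateral weighted shift similar, through `diagDecay`, to the bilateral shift. -/
noncomputable def decayShift : lp (fun _ : ℤ => ℂ) 2 →L[ℂ] lp (fun _ : ℤ => ℂ) 2 :=
  weightedShift (fun k => decayWeight k / decayWeight (k + -1)) (-1)
    fun k => norm_decayWeight_div_le (by simp)

/-- The inverse of `decayShift`. -/
noncomputable def decayShiftInv : lp (fun _ : ℤ => ℂ) 2 →L[ℂ] lp (fun _ : ℤ => ℂ) 2 :=
  weightedShift (fun k => decayWeight k / decayWeight (k + 1)) 1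
    fun k => norm_decayWeight_div_le (by simp)

theorem bilateralShift_mul_inv : bilateralShift * bilateralShiftInv = 1 := by
  ext f k
  simp [bilateralShift, bilateralShiftInv, weightedShift_apply]

theorem bilateralShiftInv_mul : bilateralShiftInv * bilateralShift = 1 := by
  ext f k
  simp [bilateralShift, bilateralShiftInv, weightedShift_apply]

theorem decayShift_mul_inv : decayShift * decayShiftInv = 1 := by
  ext f k
  simp only [decayShift, decayShiftInv, mul_apply_eq_comp, weightedShift_apply,
    one_apply_eq_self, neg_add_cancel_right]
  have h₁ := decayWeight_ne_zero k
  have h₂ := decayWeight_ne_zero (k + -1)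
  field_simp

theorem decayShiftInv_mul : decayShiftInv * decayShift = 1 := by
  ext f k
  simp only [decayShift, decayShiftInv, mul_apply_eq_comp, weightedShift_apply,
    one_apply_eq_self, add_neg_cancel_right]
  have h₁ := decayWeight_ne_zero k
  have h₂ := decayWeight_ne_zero (k + 1)
  field_simp

/-- The commutator of position with the shift is the shift itself: (k - (k - 1)) f (k - 1) = f (k -
1). Its logarithmic derivative is therefore 1. -/
theorem isLift_bilateralShift :
    IsLift diagDecay diagPosition bilateralShift decayShift bilateralShift := by
  constructor <;> intro f <;> ext k
  · simp only [diagDecay, decayShift, bilateralShift, weightedShift_apply, add_zero]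
    have h := decayWeight_ne_zero (k + -1)
    field_simp
  · simp only [diagDecay, diagPosition, decayShift, bilateralShift, weightedShift_apply,
      lp.coeFn_add, Pi.add_apply, add_zero]
    have h := decayWeight_ne_zero (k + -1)
    field_simp
    push_cast
    ring

theorem isLift_bilateralShiftInv :
    IsLift diagDecay diagPosition bilateralShiftInv decayShiftInv (-bilateralShiftInv) := by
  convert isLift_bilateralShift.inv bilateralShift_mul_inv decayShiftInv_mul using 1
  rw [mul_neg, bilateralShift_mul_inv, mul_one]

theorem exists_eq_diagDecay_add_diagPosition (f : lp (fun _ : ℤ => ℂ) 2) :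
    ∃ p q, f = diagDecay p + diagPosition q ∧ ‖p‖ ≤ ‖f‖ ∧ ‖q‖ ≤ ‖f‖ := by
  -- With q = sign(k) f the two weights add up to (1 + |k|) / (1 + |k|) = 1.
  refine ⟨f, weightedShift (fun k => (k.sign : ℤ)) 0 norm_intCast_sign_le f, ?_, le_rfl,
    by simpa using norm_weightedShift_apply_le _ 0 norm_intCast_sign_le f⟩
  ext k
  have h : (k : ℂ) * (k.sign : ℤ) = ((|(k : ℝ)| : ℝ) : ℂ) := by
    rw [← Int.cast_mul, mul_comm, Int.sign_mul_self_eq_abs]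
    rw [← Int.cast_abs, Complex.ofReal_intCast]
  have h1 : ((decayWeight k + |(k : ℝ)| * decayWeight k : ℝ) : ℂ) = 1 := by
    rw [decayWeight_add_abs_mul, Complex.ofReal_one]
  rw [Complex.ofReal_add, Complex.ofReal_mul, ← h] at h1
  simp only [diagDecay, diagPosition, weightedShift_apply, lp.coeFn_add, Pi.add_apply, add_zero]
  linear_combination (-f k) * h1

theorem norm_bilateralShift_apply (f : lp (fun _ : ℤ => ℂ) 2) : ‖bilateralShift f‖ = ‖f‖ := by
  refine le_antisymm ((norm_weightedShift_apply_le _ (-1) norm_one_le_one f).trans_eq (one_mul _)) ?_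
  have := norm_weightedShift_apply_le _ 1 norm_one_le_one (bilateralShift f)
  rw [one_mul] at this
  refine le_trans (le_of_eq ?_) this
  change _ = ‖(bilateralShiftInv * bilateralShift) f‖
  rw [bilateralShiftInv_mul, one_apply_eq_self]

theorem norm_bilateralShiftInv_apply (f : lp (fun _ : ℤ => ℂ) 2) :
    ‖bilateralShiftInv f‖ = ‖f‖ := by
  rw [← norm_bilateralShift_apply, ← mul_apply_eq_comp, bilateralShift_mul_inv, one_apply_eq_self]

theorem diagDecay_injective {f : lp (fun _ : ℤ => ℂ) 2} (h : diagDecay f = 0) : f = 0 := by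
  ext k
  have := congrArg (fun g : lp (fun _ : ℤ => ℂ) 2 => g k) h
  simpa only [diagDecay, weightedShift_apply, add_zero, lp.coeFn_zero, Pi.zero_apply, mul_eq_zero,
    decayWeight_ne_zero, false_or] using this

theorem nontrivial_lp_int : Nontrivial (lp (fun _ : ℤ => ℂ) 2) :=
  ⟨lp.single 2 0 1, 0, fun h => one_ne_zero (α := ℂ) (by
    simpa using congrArg (fun f : lp (fun _ : ℤ => ℂ) 2 => f 0) h)⟩

theorem commute_bilateralShift : Commute bilateralShift bilateralShiftInv :=
  bilateralShift_mul_inv.trans bilateralShiftInv_mul.symm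

theorem norm_eq_one_of_mem_spectrum_bilateralShift {z : ℂ}
    (hz : z ∈ spectrum ℂ bilateralShift) : ‖z‖ = 1 := by
  have := nontrivial_lp_int
  have key : ∀ u : lp (fun _ : ℤ => ℂ) 2 →L[ℂ] lp (fun _ : ℤ => ℂ) 2, (∀ f, ‖u f‖ = ‖f‖) →
      ∀ n : ℕ, ‖u ^ n‖ ≤ 1 * (n + 1) := fun u hu n =>
    ContinuousLinearMap.opNorm_le_bound _ (by positivity) fun f =>
      (norm_pow_apply_le (fun f => (hu f).le) n f).trans
        (le_mul_of_one_le_left (norm_nonneg f) (by linarith [Nat.cast_nonneg (α := ℝ) n]))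
  exact norm_eq_one_of_mem_spectrum bilateralShift_mul_inv bilateralShiftInv_mul
    (key _ norm_bilateralShift_apply) (key _ norm_bilateralShiftInv_apply) hz

theorem memℓp_decayWeight_mul {z : ℂ} (hz : ‖z‖ = 1) :
    Memℓp (fun k : ℤ => (decayWeight k : ℂ) * z ^ (-k)) 2 := by
  refine memℓp_gen (Summable.of_norm_bounded_eventually
    (Real.summable_one_div_int_pow.2 one_lt_two) ?_)
  filter_upwards [(Set.finite_singleton (0 : ℤ)).compl_mem_cofinite] with k hk
  have hk0 : (0 : ℝ) < |(k : ℝ)| := abs_pos.2 (by exact_mod_cast hk)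
  rw [norm_mul, norm_zpow, hz, one_zpow, mul_one, Complex.norm_real, ENNReal.toReal_ofNat,
    Real.rpow_ofNat, norm_pow, norm_norm, Real.norm_of_nonneg (decayWeight_pos k).le,
    ← sq_abs (k : ℝ), one_div, ← inv_pow]
  refine pow_le_pow_left₀ (decayWeight_pos k).le ?_ 2
  exact inv_anti₀ hk0 (by linarith)

/-- Powers of the shift and of its inverse grow at most linearly, which confines the spectrum to the
circle. Conversely each unimodular z is an eigenvalue: the decaying weight brings the formal
eigenvector z^{-k} into ℓ². -/
theorem spectrum_decayShift : spectrum ℂ decayShift = Metric.sphere 0 1 := by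
  have := nontrivial_lp_int
  ext z
  rw [mem_sphere_zero_iff_norm]
  constructor
  · intro hz
    have hS : IsLift diagDecay diagPosition bilateralShift decayShift (bilateralShift * 1) := by
      simpa using isLift_bilateralShift
    have hS' : IsLift diagDecay diagPosition bilateralShiftInv decayShiftInv
        (bilateralShiftInv * -1) := by
      simpa using isLift_bilateralShiftInv
    obtain ⟨C, hC⟩ := hS.exists_norm_pow_le exists_eq_diagDecay_add_diagPosition
      (Commute.one_right _) fun f => (norm_bilateralShift_apply f).le
    obtain ⟨C', hC'⟩ := hS'.exists_norm_pow_le exists_eq_diagDecay_add_diagPosition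
      (Commute.one_right _).neg_right fun f => (norm_bilateralShiftInv_apply f).le
    exact norm_eq_one_of_mem_spectrum decayShift_mul_inv decayShiftInv_mul hC hC' hz
  · intro hz
    have hz0 : z ≠ 0 := norm_ne_zero_iff.1 (hz.trans_ne one_ne_zero)
    let f : lp (fun _ : ℤ => ℂ) 2 := ⟨_, memℓp_decayWeight_mul hz⟩
    have hf : ∀ k, f k = (decayWeight k : ℂ) * z ^ (-k) := fun k => rfl
    have hTf : decayShift f = z • f := by
      ext k
      have h := decayWeight_ne_zero (k + -1)
      rw [decayShift, weightedShift_apply, lp.coeFn_smul, Pi.smul_apply, smul_eq_mul, hf, hf,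
        neg_add, neg_neg, zpow_add₀ hz0, zpow_one]
      field_simp
    rw [spectrum.mem_iff]
    rintro ⟨v, hv⟩
    have h0 : f = 0 := by
      have h1 : (v : lp (fun _ : ℤ => ℂ) 2 →L[ℂ] lp (fun _ : ℤ => ℂ) 2) f = 0 := by
        rw [hv, Algebra.algebraMap_eq_smul_one, sub_apply, smul_apply, one_apply_eq_self, hTf,
          sub_self]
      rw [← one_apply_eq_self (F := lp (fun _ : ℤ => ℂ) 2 →L[ℂ] lp (fun _ : ℤ => ℂ) 2) f,
        ← v.inv_mul, mul_apply_eq_comp, h1, map_zero]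
    have h3 := hf 0
    rw [h0] at h3
    exact decayWeight_ne_zero 0 (by simpa using h3.symm)

theorem isConnected_complex_circle : IsConnected (Metric.sphere (0 : ℂ) 1) :=
  isConnected_sphere (by rw [Complex.rank_real_complex]; exact Cardinal.one_lt_two) 0 zero_le_one

theorem spectrum_decayShift_sub_one :
    spectrum ℂ (decayShift - 1) = (fun z : ℂ => z - 1) '' Metric.sphere 0 1 := by
  have h := spectrum.sub_singleton_eq decayShift (1 : ℂ)
  rw [map_one, spectrum_decayShift] at h
  rw [← h, Set.sub_singleton]

theorem spectrum_decayShift_sub_inv :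
    spectrum ℂ (decayShift - decayShiftInv) = (fun z : ℂ => z - z⁻¹) '' Metric.sphere 0 1 := by
  rw [spectrum_sub_inv decayShift_mul_inv decayShiftInv_mul, spectrum_decayShift]

/-! ### Hilbert space inequalities for the unweighted symbols -/

open scoped InnerProductSpace in
theorem re_inner_bilateralShift_sub_inv (f : lp (fun _ : ℤ => ℂ) 2) :
    (⟪f, (bilateralShift - bilateralShiftInv) f⟫_ℂ).re = 0 := by
  let S : lp (fun _ : ℤ => ℂ) 2 →ₗᵢ[ℂ] lp (fun _ : ℤ => ℂ) 2 :=
    ⟨bilateralShift.toLinearMap, norm_bilateralShift_apply⟩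
  have h : ⟪bilateralShift f, bilateralShift (bilateralShiftInv f)⟫_ℂ =
      ⟪f, bilateralShiftInv f⟫_ℂ := S.inner_map_map _ _
  rw [← mul_apply_eq_comp, bilateralShift_mul_inv, one_apply_eq_self] at h
  rw [sub_apply, inner_sub_right, ← h, Complex.sub_re, sub_eq_zero]
  exact inner_re_symm (𝕜 := ℂ) _ _

theorem norm_exp_bilateralShift_sub_inv_le (f : lp (fun _ : ℤ => ℂ) 2) :
    ‖NormedSpace.exp (bilateralShift - bilateralShiftInv) f‖ ≤ ‖f‖ := by
  have := norm_sq_exp_apply_add_le (bilateralShift - bilateralShiftInv) le_rfl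
    (fun w => by rw [re_inner_bilateralShift_sub_inv]; simp) f
  exact (sq_le_sq₀ (norm_nonneg _) (norm_nonneg _)).1 (by simpa using this)

theorem norm_exp_neg_bilateralShift_sub_inv_le (f : lp (fun _ : ℤ => ℂ) 2) :
    ‖NormedSpace.exp (-(bilateralShift - bilateralShiftInv)) f‖ ≤ ‖f‖ := by
  have := norm_sq_exp_apply_add_le (-(bilateralShift - bilateralShiftInv)) le_rfl
    (fun w => by
      rw [neg_apply, inner_neg_right, Complex.neg_re, re_inner_bilateralShift_sub_inv]; simp) f
  exact (sq_le_sq₀ (norm_nonneg _) (norm_nonneg _)).1 (by simpa using this)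

theorem norm_sq_exp_bilateralShift_sub_one_add_le (f : lp (fun _ : ℤ => ℂ) 2) :
    ‖NormedSpace.exp (bilateralShift - 1) f‖ ^ 2 +
      ‖(bilateralShift - 1) (NormedSpace.exp (bilateralShift - 1) f)‖ ^ 2 ≤ ‖f‖ ^ 2 := by
  have := norm_sq_exp_apply_add_le (bilateralShift - 1) zero_le_one (fun w => by
    -- Expanding ‖w + a w‖ = ‖w‖, with w + a w the shift of w, gives 2 Re⟨w, a w⟩ + ‖a w‖² = 0, the
    -- hypothesis with s = 1.
    have h := norm_add_sq (𝕜 := ℂ) w ((bilateralShift - 1) w)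
    rw [sub_apply, one_apply_eq_self, add_sub_cancel, norm_bilateralShift_apply] at h
    rw [sub_apply, one_apply_eq_self, one_mul]
    have e : ∀ z : ℂ, RCLike.re z = z.re := fun _ => rfl
    rw [e] at h
    linarith) f
  simpa using this

/-- The operator is skew-adjoint, so the cross term vanishes. Applied to (1 + b)⁻¹ z, this is the
Ritt-type hypothesis, with equality. -/
theorem norm_sq_one_add_bilateralShift_sub_inv (f : lp (fun _ : ℤ => ℂ) 2) :
    ‖(1 + (bilateralShift - bilateralShiftInv)) f‖ ^ 2 =
      ‖f‖ ^ 2 + ‖(bilateralShift - bilateralShiftInv) f‖ ^ 2 := by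
  have h := norm_add_sq (𝕜 := ℂ) f ((bilateralShift - bilateralShiftInv) f)
  have e : ∀ z : ℂ, RCLike.re z = z.re := fun _ => rfl
  rw [e, re_inner_bilateralShift_sub_inv] at h
  rw [add_apply, one_apply_eq_self, h]
  ring

theorem ne_neg_one_of_norm_eq_one {z : ℂ} (hz : ‖z‖ = 1) : z - z⁻¹ ≠ -1 := by
  rw [Complex.inv_eq_conj hz]
  intro h
  have := congrArg Complex.re h
  norm_num at this

theorem isUnit_one_add_of_neg_one_notMem {R : Type*} [Ring R] [Algebra ℂ R] {b : R}
    (h : (-1 : ℂ) ∉ spectrum ℂ b) : IsUnit (1 + b) := by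
  rw [spectrum.notMem_iff, map_neg, map_one, ← neg_add', IsUnit.neg_iff] at h
  exact h

/-! ### Dense sets of null orbits and hereditary hypercyclicity -/

theorem dense_span_of_forall_inner {s : Set (lp (fun _ : ℤ => ℂ) 2)}
    (h : ∀ f : lp (fun _ : ℤ => ℂ) 2, (∀ g ∈ s, inner ℂ g f = 0) → f = 0) :
    Dense (Submodule.span ℂ s : Set (lp (fun _ : ℤ => ℂ) 2)) := by
  rw [Submodule.dense_iff_topologicalClosure_eq_top, Submodule.topologicalClosure_eq_top_iff,
    Submodule.eq_bot_iff]
  intro f hf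
  exact h f fun g hg => (Submodule.mem_orthogonal _ _).1 hf g (Submodule.subset_span hg)

theorem separableSpace_lp_int : TopologicalSpace.SeparableSpace (lp (fun _ : ℤ => ℂ) 2) := by
  have hd := dense_span_of_forall_inner (s := Set.range fun j : ℤ => lp.single 2 j (1 : ℂ))
    fun f hf => by
      ext j
      simpa [lp.inner_single_left] using hf _ ⟨j, rfl⟩
  rw [← TopologicalSpace.isSeparable_univ_iff, ← hd.closure_eq]
  exact (Set.countable_range _).isSeparable.span.closure

theorem diagPosition_single (j : ℤ) :
    diagPosition (lp.single 2 j 1) = diagDecay ((j : ℂ) • lp.single 2 j 1) := by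
  rw [map_smul, diagPosition, diagDecay, weightedShift_single, weightedShift_single,
    ← lp.single_smul]
  simp

theorem dense_span_diagDecay :
    Dense (Submodule.span ℂ (Set.range fun j : ℤ => diagDecay (lp.single 2 j 1)) :
      Set (lp (fun _ : ℤ => ℂ) 2)) := by
  refine dense_span_of_forall_inner fun f hf => ?_
  ext j
  have : inner ℂ (diagDecay (lp.single 2 j 1)) f = 0 := hf _ ⟨j, rfl⟩
  rw [diagDecay, weightedShift_single, lp.inner_single_left] at this
  simpa [(decayWeight_pos _).ne'] using this

/-- Here S + S⁻¹ is the logarithmic derivative of exp(S - S⁻¹). If f is orthogonal to the span, then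
g = D f satisfies g(k+2) = -g(k), so |g| is constant along steps of 2, and square summability forces
g = 0. -/
theorem dense_span_diagDecay_shift_add :
    Dense (Submodule.span ℂ (Set.range fun j : ℤ =>
      diagDecay ((bilateralShift + bilateralShiftInv) (lp.single 2 j 1))) :
      Set (lp (fun _ : ℤ => ℂ) 2)) := by
  refine dense_span_of_forall_inner fun f hf => diagDecay_injective ?_
  have hstep : ∀ k, ‖diagDecay f (k + 2)‖ = ‖diagDecay f k‖ := by
    intro k
    have : inner ℂ (diagDecay ((bilateralShift + bilateralShiftInv) (lp.single 2 (k + 1) 1))) f =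
      0 := hf _ ⟨k + 1, rfl⟩
    rw [add_apply, map_add, inner_add_left, bilateralShift, bilateralShiftInv, diagDecay,
      weightedShift_single, weightedShift_single, weightedShift_single, weightedShift_single,
      lp.inner_single_left, lp.inner_single_left] at this
    have e : k + 1 - -1 - 0 = k + 2 := by ring
    have e' : k + 1 - 1 - 0 = k := by ring
    rw [e, e'] at this
    have h2 : diagDecay f (k + 2) + diagDecay f k = 0 := by
      simpa [diagDecay, weightedShift_apply, mul_comm] using this
    rw [eq_neg_of_add_eq_zero_left h2, norm_neg]
  have hs := (lp.memℓp (diagDecay f)).summable (by norm_num)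
  ext k
  have hconst : ∀ n : ℕ, ‖diagDecay f (k + 2 * n)‖ = ‖diagDecay f k‖ := by
    intro n
    induction n with
    | zero => simp
    | succ n ih =>
      rw [← ih, ← hstep (k + 2 * n), Nat.cast_succ, mul_add, mul_one, add_assoc]
  have hinj : Function.Injective fun n : ℕ => k + 2 * (n : ℤ) := fun m n h => by
    simpa using h
  have h0 := (hs.comp_injective hinj).tendsto_atTop_zero
  simp only [Function.comp_def, hconst] at h0
  have := tendsto_nhds_unique h0 tendsto_const_nhds
  simpa using this.symm

theorem isHereditarilyHypercyclic_decayShift : IsHereditarilyHypercyclic decayShift := by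
  have := separableSpace_lp_int
  have hS : IsLift diagDecay diagPosition bilateralShift decayShift (bilateralShift * 1) := by
    simpa using isLift_bilateralShift
  have hS' : IsLift diagDecay diagPosition bilateralShiftInv decayShiftInv
      (bilateralShiftInv * -1) := by
    simpa using isLift_bilateralShiftInv
  refine isHereditarilyHypercyclic_of_dense_span decayShift_mul_inv dense_span_diagDecay ?_ ?_
  · rintro _ ⟨j, rfl⟩
    exact hS.tendsto_pow_apply (Commute.one_right _) (fun f => (norm_bilateralShift_apply f).le)
      (diagPosition_single j)
  · rintro _ ⟨j, rfl⟩
    have h := (hS'.tendsto_pow_apply (Commute.one_right _).neg_right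
      (fun f => (norm_bilateralShiftInv_apply f).le) (diagPosition_single j)).neg
    simpa only [neg_apply, one_apply_eq_self, map_neg, neg_neg, neg_zero] using h

theorem isLift_bilateralShift_sub_inv :
    IsLift diagDecay diagPosition (bilateralShift - bilateralShiftInv)
      (decayShift - decayShiftInv) (bilateralShift + bilateralShiftInv) := by
  simpa only [sub_neg_eq_add] using isLift_bilateralShift.sub isLift_bilateralShiftInv

theorem commute_bilateralShift_sub_add :
    Commute (bilateralShift - bilateralShiftInv) (bilateralShift + bilateralShiftInv) :=
  ((Commute.refl _).add_right commute_bilateralShift).sub_left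
    (commute_bilateralShift.symm.add_right (Commute.refl _))

theorem isHereditarilyHypercyclic_exp_decayShift_sub_inv :
    IsHereditarilyHypercyclic (NormedSpace.exp (decayShift - decayShiftInv)) := by
  have := separableSpace_lp_int
  let := NormedAlgebra.restrictScalars ℚ ℂ (lp (fun _ : ℤ => ℂ) 2 →L[ℂ] lp (fun _ : ℤ => ℂ) 2)
  have hUV : NormedSpace.exp (decayShift - decayShiftInv) *
      NormedSpace.exp (-(decayShift - decayShiftInv)) = 1 := by
    rw [← NormedSpace.exp_add_of_commute (Commute.refl (decayShift - decayShiftInv)).neg_right,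
      add_neg_cancel, NormedSpace.exp_zero]
  have hc := commute_bilateralShift_sub_add
  have hU := isLift_bilateralShift_sub_inv.exp hc
  have hV := isLift_bilateralShift_sub_inv.neg.exp hc.neg_left.neg_right
  refine isHereditarilyHypercyclic_of_dense_span hUV dense_span_diagDecay_shift_add ?_ ?_
  · rintro _ ⟨j, rfl⟩
    exact hU.tendsto_pow_apply hc.exp_left norm_exp_bilateralShift_sub_inv_le
      (diagPosition_single j)
  · rintro _ ⟨j, rfl⟩
    have h := (hV.tendsto_pow_apply hc.neg_left.neg_right.exp_left
      norm_exp_neg_bilateralShift_sub_inv_le (diagPosition_single j)).neg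
    simpa only [neg_apply, map_neg, neg_neg, neg_zero] using h

/-! ### Failure of hypercyclicity for e^A and 1 + B -/

theorem IsLift.mul_self_ne_zero {E : lp (fun _ : ℤ => ℂ) 2 →L[ℂ] lp (fun _ : ℤ => ℂ) 2}
    {a a' A : lp (fun _ : ℤ => ℂ) 2 →L[ℂ] lp (fun _ : ℤ => ℂ) 2}
    (h : IsLift diagDecay E a A a') {f : lp (fun _ : ℤ => ℂ) 2} (hf : a (a f) ≠ 0) :
    A * A ≠ 0 := by
  intro hA
  refine hf (diagDecay_injective ?_)
  rw [h.map_left, h.map_left, ← mul_apply_eq_comp, hA, zero_apply]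

theorem not_isHypercyclic_exp_decayShift_sub_one :
    ¬ IsHypercyclic (NormedSpace.exp (decayShift - 1)) := by
  have ha : IsLift diagDecay diagPosition (bilateralShift - 1) (decayShift - 1)
      bilateralShift := by
    simpa only [sub_zero] using isLift_bilateralShift.sub IsLift.one
  have hc : Commute (bilateralShift - 1) bilateralShift :=
    (Commute.refl _).sub_left (Commute.one_left _)
  obtain ⟨C, hC⟩ := ha.exists_norm_le exists_eq_diagDecay_add_diagPosition (ha.exp hc)
    (Commute.refl _).exp_right hc.exp_left norm_sq_exp_bilateralShift_sub_one_add_le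
  refine not_isHypercyclic_of_norm_le (ha.mul_self_ne_zero (f := lp.single 2 0 1) ?_) hC
  intro h
  have := congrArg (fun f : lp (fun _ : ℤ => ℂ) 2 => f 0) h
  simp [bilateralShift, weightedShift_single] at this

theorem not_isHypercyclic_one_add_decayShift_sub_inv :
    ¬ IsHypercyclic (1 + (decayShift - decayShiftInv)) := by
  have hb := isLift_bilateralShift_sub_inv
  have hc := commute_bilateralShift_sub_add
  have hu : IsUnit (1 + (bilateralShift - bilateralShiftInv)) := by
    refine isUnit_one_add_of_neg_one_notMem ?_
    rw [spectrum_sub_inv bilateralShift_mul_inv bilateralShiftInv_mul]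
    rintro ⟨z, hz, h⟩
    exact ne_neg_one_of_norm_eq_one (norm_eq_one_of_mem_spectrum_bilateralShift hz) h
  have hU : IsUnit (1 + (decayShift - decayShiftInv)) := by
    refine isUnit_one_add_of_neg_one_notMem ?_
    rw [spectrum_decayShift_sub_inv]
    rintro ⟨z, hz, h⟩
    exact ne_neg_one_of_norm_eq_one (mem_sphere_zero_iff_norm.1 hz) h
  obtain ⟨v, h₁, h₂⟩ := isUnit_iff_exists.1 hu
  obtain ⟨V, -, hV⟩ := isUnit_iff_exists.1 hU
  have hv := (IsLift.one.add hb).inv h₁ hV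
  rw [zero_add] at hv
  -- An inverse commutes with whatever commutes with 1 + b; this supplies the commutation hypotheses
  -- for v and its logarithmic derivative.
  have hcomm : ∀ x, Commute (bilateralShift - bilateralShiftInv) x → Commute v x := by
    intro x hx
    have h := ((Commute.one_left x).add_left hx).eq
    calc v * x = v * (x * (1 + (bilateralShift - bilateralShiftInv))) * v := by
          rw [mul_assoc, mul_assoc, h₁, mul_one]
      _ = x * v := by rw [← h, ← mul_assoc, h₂, one_mul]
  obtain ⟨C, hC⟩ := hb.exists_norm_le exists_eq_diagDecay_add_diagPosition hv
    (hcomm _ (Commute.refl _)).symm ((hcomm _ hc).mul_right (Commute.refl v)).neg_right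
    fun z => by
      rw [← norm_sq_one_add_bilateralShift_sub_inv, ← mul_apply_eq_comp, h₁, one_apply_eq_self]
  refine not_isHypercyclic_of_norm_inv_le hV (hb.mul_self_ne_zero (f := lp.single 2 0 1) ?_) hC
  intro h
  -- (S - S⁻¹)² e₀ = e₂ - 2e₀ + e₋₂ has coefficient 1 at index 2.
  have := congrArg (fun f : lp (fun _ : ℤ => ℂ) 2 => f 2) h
  simp [bilateralShift, bilateralShiftInv, weightedShift_single] at this

/-! ### Transfer by similarity to an arbitrary separable Hilbert space -/

theorem IsUniversalFamily.conj {X Y : Type*} [NormedAddCommGroup X] [NormedSpace ℂ X]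
    [NormedAddCommGroup Y] [NormedSpace ℂ Y] (e : X ≃L[ℂ] Y) {T : X →L[ℂ] X} {t : ℕ → ℕ}
    (h : IsUniversalFamily fun (n : ℕ) (x : X) => (T ^ t n) x) :
    IsUniversalFamily fun (n : ℕ) (y : Y) => (e.conjContinuousAlgEquiv T ^ t n) y := by
  obtain ⟨x, hx⟩ := h
  refine ⟨e x, ?_⟩
  convert e.surjective.denseRange.dense_image e.continuous hx using 1
  rw [← Set.range_comp]
  congr 1
  ext n
  simp [← map_pow]

theorem exists_operators {X : Type*} [NormedAddCommGroup X] [NormedSpace ℂ X] [CompleteSpace X]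
    (e : lp (fun _ : ℤ => ℂ) 2 ≃L[ℂ] X) :
    ∃ A B : X →L[ℂ] X,
      IsConnected (spectrum ℂ A) ∧ (0 : ℂ) ∈ spectrum ℂ A ∧
      IsConnected (spectrum ℂ B) ∧ (0 : ℂ) ∈ spectrum ℂ B ∧
      IsHereditarilyHypercyclic (1 + A) ∧
      IsHereditarilyHypercyclic (NormedSpace.exp B) ∧
      ¬ IsHypercyclic (NormedSpace.exp A) ∧
      ¬ IsHypercyclic (1 + B) := by
  let φ := e.conjContinuousAlgEquiv
  have hspec : ∀ T, spectrum ℂ (φ T) = spectrum ℂ T := fun T =>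
    AlgEquiv.spectrum_eq φ.toAlgEquiv T
  let := NormedAlgebra.restrictScalars ℚ ℂ (lp (fun _ : ℤ => ℂ) 2 →L[ℂ] lp (fun _ : ℤ => ℂ) 2)
  let := NormedAlgebra.restrictScalars ℚ ℂ (X →L[ℂ] X)
  have hexp : ∀ T, NormedSpace.exp (φ T) = φ (NormedSpace.exp T) := fun T =>
    (NormedSpace.map_exp φ φ.continuous T).symm
  have hone : ∀ T, 1 + φ T = φ (1 + T) := fun T => by rw [map_add, map_one]
  have hher : ∀ T, IsHereditarilyHypercyclic T → IsHereditarilyHypercyclic (φ T) :=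
    fun T hT t ht => (hT t ht).conj e
  have hhyp : ∀ T, ¬ IsHypercyclic T → ¬ IsHypercyclic (φ T) := fun T hT h => hT <| by
    have := IsUniversalFamily.conj e.symm (t := id) h
    rwa [← e.symm_conjContinuousAlgEquiv, ContinuousAlgEquiv.symm_apply_apply] at this
  refine ⟨φ (decayShift - 1), φ (decayShift - decayShiftInv), ?_, ?_, ?_, ?_, ?_, ?_, ?_, ?_⟩
  · rw [hspec, spectrum_decayShift_sub_one]
    exact isConnected_complex_circle.image _ (by fun_prop)
  · rw [hspec, spectrum_decayShift_sub_one]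
    exact ⟨1, by simp, by simp⟩
  · rw [hspec, spectrum_decayShift_sub_inv]
    refine isConnected_complex_circle.image _ (continuousOn_id.sub
      (continuousOn_id.inv₀ fun z hz => ?_))
    exact norm_ne_zero_iff.1 ((mem_sphere_zero_iff_norm.1 hz).trans_ne one_ne_zero)
  · rw [hspec, spectrum_decayShift_sub_inv]
    exact ⟨1, by simp, by simp⟩
  · rw [hone, add_sub_cancel]
    exact hher _ isHereditarilyHypercyclic_decayShift
  · rw [hexp]
    exact hher _ isHereditarilyHypercyclic_exp_decayShift_sub_inv
  · rw [hexp]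
    exact hhyp _ not_isHypercyclic_exp_decayShift_sub_one
  · rw [hone]
    exact hhyp _ not_isHypercyclic_one_add_decayShift_sub_inv

theorem Orthonormal.countable_of_separableSpace {H : Type*} [NormedAddCommGroup H]
    [InnerProductSpace ℂ H] [TopologicalSpace.SeparableSpace H] {ι : Type*} {v : ι → H}
    (hv : Orthonormal ℂ v) : Countable ι := by
  have hdist : ∀ i j, i ≠ j → 1 ≤ dist (v i) (v j) := by
    intro i j hij
    have h := norm_sub_sq (𝕜 := ℂ) (v i) (v j)
    rw [hv.2 hij, hv.1 i, hv.1 j, ← dist_eq_norm] at h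
    norm_num at h
    nlinarith [dist_nonneg (x := v i) (y := v j)]
  refine Set.countable_univ_iff.1 (Set.PairwiseDisjoint.countable_of_isOpen
    (s := fun i => Metric.ball (v i) (1 / 2)) ?_ (fun i _ => Metric.isOpen_ball)
    fun i _ => ⟨v i, Metric.mem_ball_self (by norm_num)⟩)
  intro i _ j _ hij
  exact Metric.ball_disjoint_ball (by norm_num; exact hdist i j hij)

/-- A Hilbert basis indexed by a type equivalent to `ℤ` identifies the space with `ℓ²(ℤ)`. -/
theorem HilbertBasis.nonempty_lp_int_equiv {H : Type*} [NormedAddCommGroup H]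
    [InnerProductSpace ℂ H] [CompleteSpace H] {ι : Type*} (b : HilbertBasis ι ℂ H) (σ : ℤ ≃ ι) :
    Nonempty (lp (fun _ : ℤ => ℂ) 2 ≃L[ℂ] H) := by
  have hsp : ⊤ ≤ (Submodule.span ℂ (Set.range (b ∘ σ))).topologicalClosure := by
    rw [σ.surjective.range_comp, b.dense_span]
  exact ⟨(HilbertBasis.mk (b.orthonormal.comp σ σ.injective)
    hsp).repr.symm.toContinuousLinearEquiv⟩

theorem nonempty_lp_int_equiv_of_not_finiteDimensional (H : Type*) [NormedAddCommGroup H]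
    [InnerProductSpace ℂ H] [CompleteSpace H] [TopologicalSpace.SeparableSpace H]
    (hH : ¬ FiniteDimensional ℂ H) : Nonempty (lp (fun _ : ℤ => ℂ) 2 ≃L[ℂ] H) := by
  obtain ⟨w, b, -⟩ := exists_hilbertBasis ℂ H
  have hcount : Countable w := b.orthonormal.countable_of_separableSpace
  have hinf : Infinite w := by
    by_contra hfin
    rw [not_infinite_iff_finite] at hfin
    have := Fintype.ofFinite w
    exact hH b.toOrthonormalBasis.toBasis.finiteDimensional_of_finite
  obtain ⟨σ⟩ := nonempty_equiv_of_countable (α := ℤ) (β := w)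
  exact b.nonempty_lp_int_equiv σ

/-- This places a copy of ℓ²(ℤ) in the universe u, where the counterexamples to the two implications
must live. -/
theorem nonempty_lp_int_equiv_lp_uLift :
    Nonempty (lp (fun _ : ℤ => ℂ) 2 ≃L[ℂ] lp (fun _ : ULift.{u} ℤ => ℂ) 2) :=
  HilbertBasis.nonempty_lp_int_equiv ⟨LinearIsometryEquiv.refl ℂ _⟩ Equiv.ulift.symm

theorem mainTheorem6 :
    (∀ (H : Type u) [NormedAddCommGroup H] [InnerProductSpace ℂ H] [CompleteSpace H]
        [TopologicalSpace.SeparableSpace H], ¬ FiniteDimensional ℂ H →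
      ∃ A B : H →L[ℂ] H,
        IsConnected (spectrum ℂ A) ∧ (0 : ℂ) ∈ spectrum ℂ A ∧
        IsConnected (spectrum ℂ B) ∧ (0 : ℂ) ∈ spectrum ℂ B ∧
        IsHereditarilyHypercyclic (1 + A) ∧
        IsHereditarilyHypercyclic (NormedSpace.exp B) ∧
        ¬ IsHypercyclic (NormedSpace.exp A) ∧
        ¬ IsHypercyclic (1 + B)) ∧
    (¬ ∀ (X : Type u) [NormedAddCommGroup X] [NormedSpace ℂ X] [CompleteSpace X]
        (T : X →L[ℂ] X), IsConnected (spectrum ℂ T) → (0 : ℂ) ∈ spectrum ℂ T →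
        IsHypercyclic (1 + T) → IsHypercyclic (NormedSpace.exp T)) ∧
    (¬ ∀ (X : Type u) [NormedAddCommGroup X] [NormedSpace ℂ X] [CompleteSpace X]
        (T : X →L[ℂ] X), IsConnected (spectrum ℂ T) → (0 : ℂ) ∈ spectrum ℂ T →
        IsHypercyclic (NormedSpace.exp T) → IsHypercyclic (1 + T)) := by
  refine ⟨fun H _ _ _ _ hH => ?_, fun h => ?_, fun h => ?_⟩
  · obtain ⟨e⟩ := nonempty_lp_int_equiv_of_not_finiteDimensional H hH
    exact exists_operators e
  · obtain ⟨e⟩ := nonempty_lp_int_equiv_lp_uLift.{u}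
    obtain ⟨A, -, hA, hA0, -, -, hher, -, hA', -⟩ := exists_operators e
    exact hA' (h _ A hA hA0 (hher id Filter.tendsto_id))
  · obtain ⟨e⟩ := nonempty_lp_int_equiv_lp_uLift.{u}
    obtain ⟨-, B, -, -, hB, hB0, -, hher, -, hB'⟩ := exists_operators e
    exact hB' (h _ B hB hB0 (hher id Filter.tendsto_id))
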